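/- Let $M$ be a compact smooth Riemannian manifold (without boundary) of dimension $d$, with Riemannian distance $d(\cdot,\cdot)$ (equal to $+\infty$ for points in different connected components), and let $T:M\to M$ be a transitive Anosov ($\mathcal C^1$-)diffeomorphism. That is, $T$ has a dense orbit, and there are a splitting $TM=E^u\oplus E^s$ with $dT_x(E^i(x))=E^i(T(x))$ for $i\in\{u,s\}$ and all $x\in M$, and constants $0<\lambda<1$, $C_0>0$ such that for all $n\in\mathbb N$ $$\|dT^{-n}v\|\le C_0\lambda^n\|v\|\ \ (v\in E^u),\qquad \|dT^{n}v\|\le C_0\lambda^n\|v\|\ \ (v\in E^s).$$ Then the limits $$\Lambda^{\pm}:=\lim_{n\to\infty}\max_{x\in M}\|d(T^{\pm n})_x\|^{1/n}$$ exist, and with $\Lambda:=\max(\Lambda^+,\Lambda^-)$ the following holds: for every real $\Lambda'>\Lambda$ there is $C>0$ such that for every integer $n\ge 1$ and all $x\ne y$ in $M$ with $T^nx=x$ and $T^ny=y$, $$d(x,y)\ \ge\ \frac{C}{\Lambda'^{\,n/2}}.$$ -/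

import Mathlib

open Bundle
open scoped Manifold ContDiff Topology

noncomputable section

/-- A diffeomorphism `T` of a Riemannian manifold `M` is *Anosov* if the tangent bundle splits as
`TM = Eu ⊕ Es`, where the splitting is invariant under `dT`, and vectors of `Eu` (resp. `Es`) are
uniformly exponentially contracted by `d(T⁻ⁿ)` (resp. `d(Tⁿ)`). The norms are those of the
Riemannian metric. (Continuity of the splitting is a consequence and need not be required.) -/
def IsAnosov {d : ℕ} {M : Type*} [TopologicalSpace M] [ChartedSpace (EuclideanSpace ℝ (Fin d)) M]
    [IsManifold (𝓡 d) ∞ M] [RiemannianBundle (fun x : M => TangentSpace (𝓡 d) x)]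
    (T : Diffeomorph (𝓡 d) (𝓡 d) M M 1) : Prop :=
  ∃ Eu Es : ∀ x : M, Submodule ℝ (TangentSpace (𝓡 d) x),
    (∀ x, IsCompl (Eu x) (Es x)) ∧
    (∀ x, (Eu x).map (mfderiv (𝓡 d) (𝓡 d) T x).toLinearMap = Eu (T x)) ∧
    (∀ x, (Es x).map (mfderiv (𝓡 d) (𝓡 d) T x).toLinearMap = Es (T x)) ∧
    ∃ r C : ℝ, 0 < r ∧ r < 1 ∧ 0 < C ∧ ∀ (n : ℕ) (x : M),
      (∀ v ∈ Eu x, ‖mfderiv (𝓡 d) (𝓡 d) (T.symm^[n]) x v‖ ≤ C * r ^ n * ‖v‖) ∧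
      (∀ v ∈ Es x, ‖mfderiv (𝓡 d) (𝓡 d) (T^[n]) x v‖ ≤ C * r ^ n * ‖v‖)

/-- A diffeomorphism is *transitive* if it has a dense orbit `{T ^ k x | k ∈ ℤ}`. -/
def IsTransitive {d : ℕ} {M : Type*} [TopologicalSpace M]
    [ChartedSpace (EuclideanSpace ℝ (Fin d)) M] (T : Diffeomorph (𝓡 d) (𝓡 d) M M 1) : Prop :=
  ∃ x : M, Dense (Set.range fun k : ℤ => ((T.toEquiv : Equiv.Perm M) ^ k) x)

/-- `max_x ‖d(Tⁿ)_x‖ ^ (1/n)`, the operator norm being taken with respect to the Riemannian metric.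
On a compact manifold the supremum is a maximum. -/
def expansionRoot {d : ℕ} {M : Type*} [TopologicalSpace M]
    [ChartedSpace (EuclideanSpace ℝ (Fin d)) M]
    [IsManifold (𝓡 d) ∞ M] [RiemannianBundle (fun x : M => TangentSpace (𝓡 d) x)]
    (T : Diffeomorph (𝓡 d) (𝓡 d) M M 1) (n : ℕ) : ℝ :=
  ⨆ x : M, ‖mfderiv (𝓡 d) (𝓡 d) (T^[n]) x‖ ^ ((1 : ℝ) / n)

/-- `lim_n max_x ‖d(Tⁿ)_x‖ ^ (1/n)`. -/
def expansionLimit {d : ℕ} {M : Type*} [TopologicalSpace M]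
    [ChartedSpace (EuclideanSpace ℝ (Fin d)) M]
    [IsManifold (𝓡 d) ∞ M] [RiemannianBundle (fun x : M => TangentSpace (𝓡 d) x)]
    (T : Diffeomorph (𝓡 d) (𝓡 d) M M 1) : ℝ :=
  Filter.limUnder Filter.atTop (expansionRoot T)

/-- `Λ = max (Λ⁺, Λ⁻)`, where `Λ^± = lim_n max_x ‖d(T^{±n})_x‖ ^ (1/n)`. -/
def expansionRate {d : ℕ} {M : Type*} [TopologicalSpace M]
    [ChartedSpace (EuclideanSpace ℝ (Fin d)) M]
    [IsManifold (𝓡 d) ∞ M] [RiemannianBundle (fun x : M => TangentSpace (𝓡 d) x)]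
    (T : Diffeomorph (𝓡 d) (𝓡 d) M M 1) : ℝ :=
  max (expansionLimit T) (expansionLimit T.symm)

end

/-! Two distinct points of period n must separate to a fixed scale ε somewhere along their orbits,
and that moment is at most n/2 steps away from time 0, forwards or backwards.

Separation (`exists_le_edist_iterate_of_expansion`): hyperbolicity makes a high iterate of T or of
its inverse stretch each tangent vector (`IsAnosov.exists_iterate_expansion`). Charts with uniform
bi-Lipschitz constants turn this into doubling of all distances below ε (`exists_edist_expansion`).
If two periodic orbits stayed ε-close, doubling their largest distance would give a larger one on
the same orbits.

Rate: if the orbits are ε apart at time j < n, that time is reached by j steps of T or n - j steps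
of the inverse, and one of these numbers m is at most n/2. The corresponding iterate is Lipschitz
with constant at most C Λ'^m (`edist_le_supNormMFDeriv_mul`, `exists_supNormMFDeriv_iterate_le`), so
the initial distance is at least ε / (C Λ'^(n/2)). The limits exist by Fekete's lemma. -/

open scoped ENNReal NNReal in
-- Riemannian distance is an infimum of path lengths, so bounds come for each `r` above it;
-- finiteness of `e` ensures such `r` exist.
lemma ENNReal.le_coe_mul_of_forall_gt {a e : ℝ≥0∞} {C : ℝ≥0} (he : e ≠ ⊤)
    (h : ∀ r, e < r → a ≤ C * r) : a ≤ C * e := by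
  have hc : Filter.Tendsto (fun r : ℝ≥0∞ => C * r) (𝓝[>] e) (𝓝 (C * e)) :=
    ((ENNReal.continuous_const_mul ENNReal.coe_ne_top).tendsto e).mono_left nhdsWithin_le_nhds
  have : (𝓝[>] e).NeBot := nhdsGT_neBot_of_exists_gt ⟨⊤, he.lt_top⟩
  exact ge_of_tendsto hc (Filter.eventually_of_mem self_mem_nhdsWithin fun r hr => h r hr)

/-! ### Uniform bi-Lipschitz control of charts. -/

section RiemannianCharts

open Set Filter Manifold MeasureTheory
open scoped ENNReal NNReal

variable {E : Type*} [NormedAddCommGroup E] [NormedSpace ℝ E]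
  {H : Type*} [TopologicalSpace H] (I : ModelWithCorners ℝ E H)
  {M : Type*} [EMetricSpace M] [ChartedSpace H M]

/-- The derivative of the preferred chart at `c`, with values in the model space. -/
noncomputable def chartDeriv (c p : M) : TangentSpace I p →L[ℝ] E :=
  mfderiv I 𝓘(ℝ, E) (extChartAt I c) p

variable [RiemannianBundle (fun x : M => TangentSpace I x)]

/-- The chart at `c` is bi-Lipschitz near `p`, with constant `L`, both for the distance and at the
level of its derivative at `p`. -/
def ChartControl (L : ℝ≥0) (c p : M) : Prop :=
  p ∈ (chartAt H c).source ∧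
  (∀ᶠ z : M × M in 𝓝 (p, p),
    edist z.1 z.2 ≤ L * edist (extChartAt I c z.1) (extChartAt I c z.2) ∧
    edist (extChartAt I c z.1) (extChartAt I c z.2) ≤ L * edist z.1 z.2) ∧
  ∀ v : TangentSpace I p, ‖v‖ ≤ L * ‖chartDeriv I c p v‖ ∧ ‖chartDeriv I c p v‖ ≤ L * ‖v‖

lemma ChartControl.mono {L L' : ℝ≥0} (hL : L ≤ L') {c p : M} (h : ChartControl I L c p) :
    ChartControl I L' c p := by
  refine ⟨h.1, ?_, fun v => ⟨(h.2.2 v).1.trans (by gcongr), (h.2.2 v).2.trans (by gcongr)⟩⟩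
  filter_upwards [h.2.1] with z hz
  exact ⟨hz.1.trans (by gcongr), hz.2.trans (by gcongr)⟩

/-- A `C¹` map whose derivative is bounded by `C` is `C`-Lipschitz for the Riemannian distance. -/
lemma edist_le_of_norm_mfderiv_le [IsRiemannianManifold I M] {f : M → M} (hf : ContMDiff I I 1 f)
    {C : ℝ≥0} (hC : ∀ x (v : TangentSpace I x), ‖mfderiv I I f x v‖ ≤ C * ‖v‖) {x y : M}
    (hxy : edist x y ≠ ⊤) : edist (f x) (f y) ≤ C * edist x y := by
  refine ENNReal.le_coe_mul_of_forall_gt hxy fun r hr => ?_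
  rw [IsRiemannianManifold.out (I := I) x y] at hr
  obtain ⟨γ, hγ0, hγ1, hγ, hlen⟩ := exists_lt_of_riemannianEDist_lt hr
  calc edist (f x) (f y) = riemannianEDist I (f x) (f y) := IsRiemannianManifold.out _ _
    _ ≤ pathELength I (f ∘ γ) 0 1 :=
      riemannianEDist_le_pathELength (hf.comp_contMDiffOn hγ) (by simp [hγ0]) (by simp [hγ1])
        zero_le_one
    _ ≤ C * pathELength I γ 0 1 := by
      rw [pathELength_eq_lintegral_mfderivWithin_Icc, pathELength_eq_lintegral_mfderivWithin_Icc,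
        ← lintegral_const_mul' _ _ ENNReal.coe_ne_top]
      refine setLIntegral_mono' measurableSet_Icc fun t ht => ?_
      have h1 : mfderivWithin 𝓘(ℝ, ℝ) I (f ∘ γ) (Icc 0 1) t =
          (mfderiv I I f (γ t)) ∘L (mfderivWithin 𝓘(ℝ, ℝ) I γ (Icc 0 1) t) := by
        apply mfderiv_comp_mfderivWithin
        · exact hf.mdifferentiable one_ne_zero _
        · exact hγ.mdifferentiableOn one_ne_zero t ht
        · rw [uniqueMDiffWithinAt_iff_uniqueDiffWithinAt]
          exact uniqueDiffOn_Icc zero_lt_one t ht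
      have h2 : mfderivWithin 𝓘(ℝ, ℝ) I (f ∘ γ) (Icc 0 1) t 1 =
          mfderiv I I f (γ t) (mfderivWithin 𝓘(ℝ, ℝ) I γ (Icc 0 1) t 1) := congr($h1 1)
      rw [h2, ← ofReal_norm, ← ofReal_norm, ← ENNReal.ofReal_coe_nnreal,
        ← ENNReal.ofReal_mul C.coe_nonneg]
      exact ENNReal.ofReal_le_ofReal (hC _ _)
    _ ≤ C * r := by gcongr

variable [IsManifold I 1 M] [IsContinuousRiemannianBundle E (fun x : M => TangentSpace I x)]

attribute [local instance] normedAddCommGroupTangentSpaceVectorSpace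
attribute [local instance] normedSpaceTangentSpaceVectorSpace

lemma eventually_chartDeriv_bounds (c : M) :
    ∃ C : ℝ≥0, ∀ᶠ p in 𝓝 c, ∀ v : TangentSpace I p,
      ‖v‖ ≤ C * ‖chartDeriv I c p v‖ ∧ ‖chartDeriv I c p v‖ ≤ C * ‖v‖ := by
  obtain ⟨C₁, h₁, H₁⟩ := eventually_norm_mfderiv_extChartAt_lt I c
  obtain ⟨C₂, h₂, H₂⟩ := eventually_norm_mfderivWithin_symm_extChartAt_comp_lt I c
  lift C₁ to ℝ≥0 using h₁.le
  lift C₂ to ℝ≥0 using h₂.le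
  refine ⟨max C₁ C₂, ?_⟩
  filter_upwards [H₁, H₂, extChartAt_source_mem_nhds (I := I) c] with p hp₁ hp₂ hp v
  constructor
  · have h1 := mfderivWithin_extChartAt_symm_comp_mfderiv_extChartAt' (I := I) hp
    have h2 : mfderivWithin 𝓘(ℝ, E) I (extChartAt I c).symm (range I) (extChartAt I c p)
      (mfderiv I 𝓘(ℝ, E) (extChartAt I c) p v) = v := congr($h1 v)
    have h3 := (mfderivWithin 𝓘(ℝ, E) I (extChartAt I c).symm (range I)
      (extChartAt I c p)).le_opNorm (mfderiv I 𝓘(ℝ, E) (extChartAt I c) p v)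
    have h4 : ‖v‖ = ‖mfderivWithin 𝓘(ℝ, E) I (extChartAt I c).symm (range I) (extChartAt I c p)
      (mfderiv I 𝓘(ℝ, E) (extChartAt I c) p v)‖ := by
      -- The norm depends on the base point, and `left_inv` identifies the two base points only
      -- propositionally.
      have h5 : ∀ q, q = p → ∀ w : E, ‖(show TangentSpace I p from w)‖ =
          ‖(show TangentSpace I q from w)‖ := by
        rintro _ rfl w
        rfl
      refine Eq.trans ?_ (h5 _ ((extChartAt I c).left_inv hp) _)
      exact congrArg (fun w : TangentSpace I p => ‖w‖) h2.symm
    rw [h4]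
    refine h3.trans (mul_le_mul ?_ le_rfl (norm_nonneg _) (by positivity))
    exact hp₂.le.trans (by simp)
  · refine (ContinuousLinearMap.le_opNorm (mfderiv I 𝓘(ℝ, E) (extChartAt I c) p) v).trans ?_
    gcongr
    exact hp₁.le.trans (by simp)

/-- Near its base point, the inverse of a chart is Lipschitz. -/
lemma eventually_edist_le_edist_extChartAt [IsRiemannianManifold I M] (c : M) :
    ∃ C : ℝ≥0, ∀ᶠ z : M × M in 𝓝 (c, c),
      edist z.1 z.2 ≤ C * edist (extChartAt I c z.1) (extChartAt I c z.2) := by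
  obtain ⟨C, -, hC⟩ := eventually_enorm_mfderivWithin_symm_extChartAt_lt I c
  obtain ⟨S, hS, hSC⟩ := hC.exists_mem
  refine ⟨C, ?_⟩
  obtain ⟨r, r_pos, hr⟩ : ∃ r > 0,
      Metric.ball (extChartAt I c c) r ∩ range I ⊆ (extChartAt I c).target ∩ S :=
    Metric.mem_nhdsWithin_iff.1 (inter_mem (extChartAt_target_mem_nhdsWithin c) hS)
  have A : (extChartAt I c) ⁻¹' (Metric.ball (extChartAt I c c) r ∩ range I) ∈ 𝓝 c := by
    apply extChartAt_preimage_mem_nhds_of_mem_nhdsWithin (by simp)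
    rw [inter_comm]
    exact inter_mem_nhdsWithin _ (Metric.ball_mem_nhds _ r_pos)
  have B := inter_mem A (extChartAt_source_mem_nhds (I := I) c)
  filter_upwards [prod_mem_nhds B B] with ⟨x, y⟩ hz
  obtain ⟨⟨hx, h'x⟩, hy, h'y⟩ := hz
  -- Compare with the preimage of the coordinate segment, which stays in the chart by convexity of
  -- the ball and of `range I`.
  let η := ContinuousAffineMap.lineMap (R := ℝ) (extChartAt I c x) (extChartAt I c y)
  set γ := (extChartAt I c).symm ∘ η
  have hη : Icc 0 1 ⊆ ⇑η ⁻¹' ((extChartAt I c).target ∩ S) := by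
    simp only [← image_subset_iff, ContinuousAffineMap.coe_lineMap_eq,
      ← segment_eq_image_lineMap, η]
    exact (((convex_ball _ _).inter I.convex_range).segment_subset hx hy).trans hr
  simp only [preimage_inter, subset_inter_iff] at hη
  have η_smooth : ContMDiffOn 𝓘(ℝ, ℝ) 𝓘(ℝ, E) 1 η (Icc 0 1) := by
    apply ContMDiff.contMDiffOn
    rw [contMDiff_iff_contDiff]
    exact ContinuousAffineMap.contDiff _
  have : edist x y ≤ pathELength I γ 0 1 := by
    rw [IsRiemannianManifold.out (I := I) x y]
    apply riemannianEDist_le_pathELength _ _ _ zero_le_one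
    · exact (contMDiffOn_extChartAt_symm c).comp η_smooth hη.1
    · simpa [γ, η, ContinuousAffineMap.coe_lineMap_eq] using (extChartAt I c).left_inv h'x
    · simpa [γ, η, ContinuousAffineMap.coe_lineMap_eq] using (extChartAt I c).left_inv h'y
  apply this.trans
  rw [← lintegral_fderiv_lineMap_eq_edist, pathELength_eq_lintegral_mfderivWithin_Icc,
    ← lintegral_const_mul' _ _ ENNReal.coe_ne_top]
  apply setLIntegral_mono' measurableSet_Icc (fun t ht ↦ ?_)
  have : mfderivWithin 𝓘(ℝ, ℝ) I γ (Icc 0 1) t =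
      (mfderivWithin 𝓘(ℝ, E) I (extChartAt I c).symm (range I) (η t)) ∘L
        (mfderivWithin 𝓘(ℝ, ℝ) 𝓘(ℝ, E) η (Icc 0 1) t) := by
    apply mfderivWithin_comp
    · exact mdifferentiableWithinAt_extChartAt_symm (hη.1 ht)
    · exact η_smooth.mdifferentiableOn one_ne_zero t ht
    · exact hη.1.trans (preimage_mono (extChartAt_target_subset_range c))
    · rw [uniqueMDiffWithinAt_iff_uniqueDiffWithinAt]
      exact uniqueDiffOn_Icc zero_lt_one t ht
  have : mfderivWithin 𝓘(ℝ, ℝ) I γ (Icc 0 1) t 1 =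
      (mfderivWithin 𝓘(ℝ, E) I (extChartAt I c).symm (range I) (η t))
        (mfderivWithin 𝓘(ℝ, ℝ) 𝓘(ℝ, E) η (Icc 0 1) t 1) := congr($this 1)
  rw [this]
  apply (ContinuousLinearMap.le_opENorm _ _).trans
  gcongr
  · exact (hSC _ (hη.2 ht)).le
  · simp only [mfderivWithin_eq_fderivWithin]
    exact le_of_eq rfl

/-- Near its base point, a chart is Lipschitz. -/
lemma eventually_edist_extChartAt_le_edist [IsRiemannianManifold I M] (c : M) :
    ∃ C : ℝ≥0, ∀ᶠ z : M × M in 𝓝 (c, c),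
      edist (extChartAt I c z.1) (extChartAt I c z.2) ≤ C * edist z.1 z.2 := by
  obtain ⟨C, -, hC⟩ := eventually_enorm_mfderiv_extChartAt_lt I c
  refine ⟨C, ?_⟩
  obtain ⟨R, hR, hball⟩ := EMetric.mem_nhds_iff.1
    (inter_mem hC (chart_source_mem_nhds H c))
  -- A path of length below 2R' from a point of the R'-ball stays in the 3R'-ball, where the
  -- derivative bound holds.
  obtain ⟨R', hR', hRR'⟩ : ∃ R' : ℝ≥0∞, 0 < R' ∧ R' + (R' + R') ≤ R := by
    refine ⟨R / 3, ENNReal.div_pos hR.ne' (by simp), ?_⟩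
    rw [← add_assoc, ENNReal.add_thirds]
  have B := Metric.eball_mem_nhds c hR'
  filter_upwards [prod_mem_nhds B B] with ⟨x, y⟩ hz
  obtain ⟨hx, hy⟩ := hz
  simp only [Metric.mem_eball] at hx hy
  have hxy : edist x y < R' + R' :=
    (edist_triangle_right x y c).trans_lt (ENNReal.add_lt_add hx hy)
  refine ENNReal.le_coe_mul_of_forall_gt hxy.ne_top fun r hr => ?_
  have hr' : edist x y < min r (R' + R') := lt_min hr hxy
  rw [IsRiemannianManifold.out (I := I) x y] at hr'
  obtain ⟨γ, hγ0, hγ1, hγ, hlen⟩ := exists_lt_of_riemannianEDist_lt hr'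
  have hmem : ∀ t ∈ Icc (0 : ℝ) 1, γ t ∈ Metric.eball c R := by
    intro t ht
    rw [Metric.mem_eball]
    have h1 : edist (γ t) x ≤ pathELength I γ 0 1 := by
      rw [edist_comm, IsRiemannianManifold.out (I := I) x (γ t)]
      exact (riemannianEDist_le_pathELength (hγ.mono (Icc_subset_Icc_right ht.2)) hγ0 rfl
        ht.1).trans (pathELength_mono le_rfl ht.2)
    calc edist (γ t) c ≤ edist (γ t) x + edist x c := edist_triangle _ _ _
      _ < (R' + R') + R' := by
        exact ENNReal.add_lt_add (h1.trans_lt (hlen.trans_le (min_le_right _ _))) hx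
      _ ≤ R := by rwa [add_comm]
  let γ' := extChartAt I c ∘ γ
  have hγ' : ContMDiffOn 𝓘(ℝ, ℝ) 𝓘(ℝ, E) 1 γ' (Icc 0 1) :=
    contMDiffOn_extChartAt.comp (I' := I) (t := (chartAt H c).source) hγ
      (fun t ht => (hball (hmem t ht)).2)
  calc edist (extChartAt I c x) (extChartAt I c y)
      = ‖γ' 1 - γ' 0‖ₑ := by
        rw [edist_comm, edist_eq_enorm_sub]; simp [γ', hγ0, hγ1]
    _ ≤ ∫⁻ t in Icc 0 1, ‖derivWithin γ' (Icc 0 1) t‖ₑ := by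
      apply enorm_sub_le_lintegral_derivWithin_Icc_of_contDiffOn_Icc _ zero_le_one
      rwa [← contMDiffOn_iff_contDiffOn]
    _ = ∫⁻ t in Icc 0 1, ‖mfderivWithin 𝓘(ℝ, ℝ) 𝓘(ℝ, E) γ' (Icc 0 1) t 1‖ₑ := by
      simp_rw [← fderivWithin_derivWithin, mfderivWithin_eq_fderivWithin]
      rfl
    _ ≤ ∫⁻ t in Icc 0 1, C * ‖mfderivWithin 𝓘(ℝ, ℝ) I γ (Icc 0 1) t 1‖ₑ := by
      apply setLIntegral_mono' measurableSet_Icc (fun t ht ↦ ?_)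
      have : mfderivWithin 𝓘(ℝ, ℝ) 𝓘(ℝ, E) γ' (Icc 0 1) t =
          (mfderiv I 𝓘(ℝ, E) (extChartAt I c) (γ t)) ∘L
            (mfderivWithin 𝓘(ℝ, ℝ) I γ (Icc 0 1) t) := by
        apply mfderiv_comp_mfderivWithin
        · exact mdifferentiableAt_extChartAt (hball (hmem t ht)).2
        · exact hγ.mdifferentiableOn one_ne_zero _ ht
        · rw [uniqueMDiffWithinAt_iff_uniqueDiffWithinAt]
          exact uniqueDiffOn_Icc zero_lt_one _ ht
      have : mfderivWithin 𝓘(ℝ, ℝ) 𝓘(ℝ, E) γ' (Icc 0 1) t 1 =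
          (mfderiv I 𝓘(ℝ, E) (extChartAt I c) (γ t))
            (mfderivWithin 𝓘(ℝ, ℝ) I γ (Icc 0 1) t 1) := congr($this 1)
      rw [this]
      apply (ContinuousLinearMap.le_opENorm _ _).trans
      gcongr
      exact (hball (hmem t ht)).1.le
    _ = C * pathELength I γ 0 1 := by
      rw [lintegral_const_mul' _ _ ENNReal.coe_ne_top, pathELength_eq_lintegral_mfderivWithin_Icc]
    _ ≤ C * r := by gcongr; exact hlen.le.trans (min_le_left _ _)

lemma exists_eventually_chartControl [IsRiemannianManifold I M] (c : M) :
    ∃ L : ℝ≥0, ∀ᶠ p in 𝓝 c, ChartControl I L c p := by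
  obtain ⟨C₁, h₁⟩ := eventually_chartDeriv_bounds I c
  obtain ⟨C₂, h₂⟩ := eventually_edist_le_edist_extChartAt I c
  obtain ⟨C₃, h₃⟩ := eventually_edist_extChartAt_le_edist I c
  refine ⟨max C₁ (max C₂ C₃), ?_⟩
  -- Bounds valid near `(c, c)` are valid near `(p, p)` for every `p` close to `c`, with the same
  -- chart.
  have hdiag : Tendsto (fun p : M => (p, p)) (𝓝 c) (𝓝 (c, c)) :=
    (continuous_id.prodMk continuous_id).tendsto c
  filter_upwards [h₁, hdiag.eventually (h₂.and h₃).eventually_nhds,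
    chart_source_mem_nhds H c] with p hp₁ hp₂ hp
  refine ⟨hp, ?_, fun v => ⟨(hp₁ v).1.trans ?_, (hp₁ v).2.trans ?_⟩⟩
  · filter_upwards [hp₂] with z hz
    refine ⟨hz.1.trans ?_, hz.2.trans ?_⟩ <;> gcongr <;> simp
  all_goals
    gcongr
    exact le_max_left _ _

/-- On a compact manifold, all points have charts controlled by a uniform constant. -/
lemma exists_chartControl [IsRiemannianManifold I M] [CompactSpace M] :
    ∃ L : ℝ≥0, 1 ≤ L ∧ ∀ p : M, ∃ c, ChartControl I L c p := by
  suffices h : ∃ L : ℝ≥0, ∀ p ∈ (univ : Set M), ∃ c, ChartControl I L c p by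
    obtain ⟨L, hL⟩ := h
    refine ⟨max 1 L, le_max_left _ _, fun p => ?_⟩
    obtain ⟨c, hc⟩ := hL p trivial
    exact ⟨c, hc.mono I (le_max_right _ _)⟩
  refine isCompact_univ.induction_on
    (p := fun s : Set M => ∃ L : ℝ≥0, ∀ p ∈ s, ∃ c, ChartControl I L c p) ⟨1, by simp⟩
    (fun s t hst ⟨L, hL⟩ => ⟨L, fun p hp => hL p (hst hp)⟩) ?_ fun c _ => ?_
  · rintro s t ⟨L, hL⟩ ⟨L', hL'⟩
    refine ⟨max L L', fun p hp => ?_⟩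
    rcases hp with hp | hp
    · obtain ⟨c, hc⟩ := hL p hp
      exact ⟨c, hc.mono I (le_max_left _ _)⟩
    · obtain ⟨c, hc⟩ := hL' p hp
      exact ⟨c, hc.mono I (le_max_right _ _)⟩
  · obtain ⟨L, hL⟩ := exists_eventually_chartControl I c
    exact ⟨_, mem_nhdsWithin_of_mem_nhds hL, L, fun p hp => ⟨c, hp⟩⟩

end RiemannianCharts

/-! ### From infinitesimal to local expansion. -/

section LocalExpansion

open Set Filter Manifold
open scoped ENNReal NNReal

variable {E : Type*} [NormedAddCommGroup E] [NormedSpace ℝ E]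
  {H : Type*} [TopologicalSpace H] {I : ModelWithCorners ℝ E H}
  {M : Type*} [EMetricSpace M] [ChartedSpace H M]

lemma eventuallyEq_extChartAt_comp {f : M → M} {c c' p : M} (hp : p ∈ (chartAt H c).source) :
    extChartAt I c' ∘ f =ᶠ[𝓝 p]
      (extChartAt I c' ∘ f ∘ (extChartAt I c).symm) ∘ extChartAt I c := by
  filter_upwards [extChartAt_source_mem_nhds' (I := I) (by rwa [extChartAt_source])] with q hq
  simp only [Function.comp_apply, (extChartAt I c).left_inv hq]

/-- Allows a coordinate displacement between nearby points to be read as a tangent vector, to which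
hyperbolicity applies. -/
lemma exists_chartDeriv_eq [IsManifold I 1 M] {c p : M} (hp : p ∈ (chartAt H c).source) (w : E) :
    ∃ v : TangentSpace I p, chartDeriv I c p v = w := by
  have h := mfderiv_extChartAt_comp_mfderivWithin_extChartAt_symm' (I := I) (x := c) (y := p)
    (by rwa [extChartAt_source])
  exact ⟨mfderivWithin 𝓘(ℝ, E) I (extChartAt I c).symm (range I) (extChartAt I c p) w,
    congr($h w)⟩

variable [I.Boundaryless] [IsManifold I 1 M]

lemma contDiffAt_extChartAt_comp_symm {f : M → M} (hf : ContMDiff I I 1 f)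
    {c c' p : M} (hp : p ∈ (chartAt H c).source) (hfp : f p ∈ (chartAt H c').source) :
    ContDiffAt ℝ 1 (extChartAt I c' ∘ f ∘ (extChartAt I c).symm) (extChartAt I c p) := by
  have h := ((contMDiffAt_iff_of_mem_source hp hfp).1 (hf p)).2
  rwa [I.range_eq_univ, contDiffWithinAt_univ] at h

lemma chartDeriv_mfderiv {f : M → M} (hf : ContMDiff I I 1 f)
    {c c' p : M} (hp : p ∈ (chartAt H c).source) (hfp : f p ∈ (chartAt H c').source)
    (v : TangentSpace I p) :
    chartDeriv I c' (f p) (mfderiv I I f p v) =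
      fderiv ℝ (extChartAt I c' ∘ f ∘ (extChartAt I c).symm) (extChartAt I c p)
        (chartDeriv I c p v) := by
  have h1 := (eventuallyEq_extChartAt_comp (I := I) (f := f) (c' := c') hp).mfderiv_eq
    (I := I) (I' := 𝓘(ℝ, E))
  rw [mfderiv_comp p (mdifferentiableAt_extChartAt hfp) (hf.mdifferentiable one_ne_zero p),
    mfderiv_comp p ((contDiffAt_extChartAt_comp_symm hf hp hfp).differentiableAt
      one_ne_zero).mdifferentiableAt (mdifferentiableAt_extChartAt hp), mfderiv_eq_fderiv] at h1
  exact congr($h1 v)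

variable [RiemannianBundle (fun x : M => TangentSpace I x)]

/-- If `v` represents the displacement between two points near `p` in a chart and `df` expands `v`
enough, then `f` doubles the distance between these points. -/
lemma eventually_two_mul_edist_le {f : M → M} (hf : ContMDiff I I 1 f) {L : ℝ≥0} (hL : 1 ≤ L)
    {c c' p : M} (hp : ChartControl I L c p) (hfp : ChartControl I L c' (f p)) :
    ∀ᶠ z : M × M in 𝓝 (p, p), ∀ v : TangentSpace I p,
      chartDeriv I c p v = extChartAt I c z.1 - extChartAt I c z.2 →
      3 * (L : ℝ) ^ 4 * ‖v‖ ≤ ‖mfderiv I I f p v‖ →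
      2 * edist z.1 z.2 ≤ edist (f z.1) (f z.2) := by
  set F := extChartAt I c' ∘ f ∘ (extChartAt I c).symm with hF
  have hstrict := (contDiffAt_extChartAt_comp_symm hf hp.1 hfp.1).hasStrictFDerivAt one_ne_zero
  have hφ : Tendsto (fun z : M × M => (extChartAt I c z.1, extChartAt I c z.2)) (𝓝 (p, p))
      (𝓝 (extChartAt I c p, extChartAt I c p)) := by
    have h := continuousAt_extChartAt' (I := I) (x := c) (x' := p)
      (by rw [extChartAt_source]; exact hp.1)
    rw [nhds_prod_eq, nhds_prod_eq]
    exact h.tendsto.prodMap h.tendsto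
  have hlin := hφ.eventually (hstrict.isLittleO.def zero_lt_one)
  have hff : Tendsto (fun z : M × M => (f z.1, f z.2)) (𝓝 (p, p)) (𝓝 (f p, f p)) :=
    (hf.continuous.prodMap hf.continuous).tendsto (p, p)
  have hev := eventuallyEq_extChartAt_comp (I := I) (f := f) (c' := c') hp.1
  have hev2 : ∀ᶠ z : M × M in 𝓝 (p, p), extChartAt I c' (f z.1) = F (extChartAt I c z.1) ∧
      extChartAt I c' (f z.2) = F (extChartAt I c z.2) := by
    rw [nhds_prod_eq]
    exact hev.prod_mk hev
  filter_upwards [hlin, hp.2.1, hff.eventually hfp.2.1, hev2] with z hz h1 h2 h3 v hv hexp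
  -- Budget for 3L⁴: reading the derivative in the two charts costs L², the linearisation error
  -- costs one of the three L²‖w‖, and converting distances costs the last L², leaving 2.
  set w := extChartAt I c z.1 - extChartAt I c z.2 with hw
  have hL0 : (0 : ℝ) < L := lt_of_lt_of_le zero_lt_one (by exact_mod_cast hL)
  have hL1 : (1 : ℝ) ≤ L := by exact_mod_cast hL
  have hD : 3 * (L : ℝ) ^ 2 * ‖w‖ ≤ ‖fderiv ℝ F (extChartAt I c p) w‖ := by
    have e1 : ‖mfderiv I I f p v‖ ≤ L * ‖fderiv ℝ F (extChartAt I c p) w‖ := by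
      have := (hfp.2.2 (mfderiv I I f p v)).1
      rwa [chartDeriv_mfderiv hf hp.1 hfp.1, hv] at this
    have e2 : ‖w‖ ≤ L * ‖v‖ := by
      have := (hp.2.2 v).2
      rwa [hv] at this
    have e3 : 3 * (L : ℝ) ^ 3 * ‖w‖ ≤ L * ‖fderiv ℝ F (extChartAt I c p) w‖ :=
      calc 3 * (L : ℝ) ^ 3 * ‖w‖ ≤ 3 * (L : ℝ) ^ 3 * (L * ‖v‖) := by gcongr
        _ = 3 * (L : ℝ) ^ 4 * ‖v‖ := by ring
        _ ≤ _ := hexp.trans e1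
    refine le_of_mul_le_mul_left ?_ hL0
    linarith
  have hmain : 2 * (L : ℝ) ^ 2 * ‖w‖ ≤
      ‖extChartAt I c' (f z.1) - extChartAt I c' (f z.2)‖ := by
    rw [h3.1, h3.2]
    have e1 := norm_sub_norm_le (fderiv ℝ F (extChartAt I c p) w)
      (-(F (extChartAt I c z.1) - F (extChartAt I c z.2) - fderiv ℝ F (extChartAt I c p) w))
    rw [norm_neg] at e1
    have e2 : fderiv ℝ F (extChartAt I c p) w -
      (-(F (extChartAt I c z.1) - F (extChartAt I c z.2) - fderiv ℝ F (extChartAt I c p) w)) =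
        F (extChartAt I c z.1) - F (extChartAt I c z.2) := by abel
    rw [e2] at e1
    simp only [one_mul] at hz
    have e3 : (1 : ℝ) * ‖w‖ ≤ (L : ℝ) ^ 2 * ‖w‖ := by
      gcongr
      exact one_le_pow₀ hL1
    linarith
  have hmain' : 2 * (L : ℝ≥0∞) ^ 2 * edist (extChartAt I c z.1) (extChartAt I c z.2) ≤
      edist (extChartAt I c' (f z.1)) (extChartAt I c' (f z.2)) := by
    rw [edist_nndist, edist_nndist, nndist_eq_nnnorm, nndist_eq_nnnorm]
    exact_mod_cast hmain
  have hLt : (L : ℝ≥0∞) ≠ 0 := by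
    simpa using (zero_lt_one.trans_le hL).ne'
  refine (ENNReal.mul_le_mul_iff_right hLt ENNReal.coe_ne_top).1 ?_
  calc (L : ℝ≥0∞) * (2 * edist z.1 z.2)
      ≤ L * (2 * (L * edist (extChartAt I c z.1) (extChartAt I c z.2))) := by
        gcongr
        exact h1.1
    _ = 2 * (L : ℝ≥0∞) ^ 2 * edist (extChartAt I c z.1) (extChartAt I c z.2) := by ring
    _ ≤ _ := hmain'.trans h2.2

variable [IsContinuousRiemannianBundle E (fun x : M => TangentSpace I x)]
  [IsRiemannianManifold I M]

/-- The derivative of a `C¹` self-map of a compact Riemannian manifold is bounded. -/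
lemma exists_norm_mfderiv_le [CompactSpace M] {f : M → M} (hf : ContMDiff I I 1 f) :
    ∃ C : ℝ≥0, ∀ x (v : TangentSpace I x), ‖mfderiv I I f x v‖ ≤ C * ‖v‖ := by
  suffices h : ∃ C : ℝ≥0, ∀ x ∈ (univ : Set M), ∀ v : TangentSpace I x,
      ‖mfderiv I I f x v‖ ≤ C * ‖v‖ by simpa using h
  refine isCompact_univ.induction_on
    (p := fun s : Set M => ∃ C : ℝ≥0, ∀ x ∈ s, ∀ v : TangentSpace I x,
      ‖mfderiv I I f x v‖ ≤ C * ‖v‖) ⟨1, by simp⟩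
    (fun s t hst ⟨L, hL⟩ => ⟨L, fun p hp => hL p (hst hp)⟩) ?_ fun c _ => ?_
  · rintro s t ⟨L, hL⟩ ⟨L', hL'⟩
    refine ⟨max L L', fun p hp v => ?_⟩
    rcases hp with hp | hp
    · refine (hL p hp v).trans ?_
      gcongr
      exact le_max_left _ _
    · refine (hL' p hp v).trans ?_
      gcongr
      exact le_max_right _ _
  · obtain ⟨L, hL⟩ := exists_eventually_chartControl I c
    obtain ⟨L', hL'⟩ := exists_eventually_chartControl I (f c)
    set F := extChartAt I (f c) ∘ f ∘ (extChartAt I c).symm with hF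
    have hcont : ContinuousAt (fun q => fderiv ℝ F (extChartAt I c q)) c := by
      refine ContinuousAt.comp (g := fderiv ℝ F) ?_ (continuousAt_extChartAt c)
      exact (contDiffAt_extChartAt_comp_symm hf (mem_chart_source H c)
        (mem_chart_source H (f c))).continuousAt_fderiv one_ne_zero
    obtain ⟨K, hK⟩ : ∃ K : ℝ≥0, ∀ᶠ q in 𝓝 c, ‖fderiv ℝ F (extChartAt I c q)‖ ≤ K := by
      refine ⟨‖fderiv ℝ F (extChartAt I c c)‖₊ + 1, ?_⟩
      filter_upwards [hcont.norm.eventually_lt_const (lt_add_one _)] with q hq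
      exact hq.le
    refine ⟨_, mem_nhdsWithin_of_mem_nhds
      (hL.and ((hf.continuous.continuousAt.eventually hL').and hK)), L' * (K * L), ?_⟩
    rintro p ⟨hp, hfp, hKp⟩ v
    calc ‖mfderiv I I f p v‖ ≤ L' * ‖chartDeriv I (f c) (f p) (mfderiv I I f p v)‖ :=
          (hfp.2.2 _).1
      _ = L' * ‖fderiv ℝ F (extChartAt I c p) (chartDeriv I c p v)‖ := by
          rw [chartDeriv_mfderiv hf hp.1 hfp.1]
      _ ≤ L' * (K * (L * ‖v‖)) := by
          gcongr
          exact (ContinuousLinearMap.le_of_opNorm_le _ hKp _).trans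
            (by gcongr; exact (hp.2.2 v).2)
      _ = _ := by push_cast; ring

variable (I M) in
/-- If every tangent vector is sufficiently expanded by the derivative of one of two `C¹` maps of a
compact Riemannian manifold, then close points are pushed apart by one of these maps. -/
lemma exists_edist_expansion [CompactSpace M] : ∃ K : ℝ, ∀ f g : M → M, ContMDiff I I 1 f →
    ContMDiff I I 1 g →
    (∀ x (v : TangentSpace I x),
      K * ‖v‖ ≤ ‖mfderiv I I f x v‖ ∨ K * ‖v‖ ≤ ‖mfderiv I I g x v‖) →
    ∃ ε : ℝ≥0∞, 0 < ε ∧ ∀ x y : M, edist x y < ε →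
      2 * edist x y ≤ edist (f x) (f y) ∨ 2 * edist x y ≤ edist (g x) (g y) := by
  obtain ⟨L, hL, hchart⟩ := exists_chartControl I (M := M)
  -- The constant depends on the charts only, so the iterates `f`, `g` can be chosen after it.
  refine ⟨3 * L ^ 4, fun f g hf hg hfg => ?_⟩
  have hset : {z : M × M | 2 * edist z.1 z.2 ≤ edist (f z.1) (f z.2) ∨
      2 * edist z.1 z.2 ≤ edist (g z.1) (g z.2)} ∈ uniformity M := by
    -- By compactness, neighbourhoods of the diagonal are entourages: local expansion at each point
    -- yields a uniform ε.
    rw [← nhdsSet_diagonal_eq_uniformity, mem_nhdsSet_iff_forall]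
    rintro ⟨p, q⟩ (rfl : p = q)
    obtain ⟨c, hc⟩ := hchart p
    obtain ⟨cf, hcf⟩ := hchart (f p)
    obtain ⟨cg, hcg⟩ := hchart (g p)
    filter_upwards [eventually_two_mul_edist_le hf hL hc hcf,
      eventually_two_mul_edist_le hg hL hc hcg] with z hzf hzg
    obtain ⟨v, hv⟩ := exists_chartDeriv_eq (I := I) hc.1 (extChartAt I c z.1 - extChartAt I c z.2)
    exact (hfg p v).imp (hzf v hv) (hzg v hv)
  obtain ⟨ε, hε, h⟩ := mem_uniformity_edist.1 hset
  exact ⟨ε, hε, fun x y hxy => h hxy⟩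

end LocalExpansion

/-! ### Growth rate of the derivative. -/

section ExpansionRate

open Set Filter Manifold
open scoped ENNReal NNReal

variable {d : ℕ} {M : Type*} [EMetricSpace M] [ChartedSpace (EuclideanSpace ℝ (Fin d)) M]
  [RiemannianBundle (fun x : M => TangentSpace (𝓡 d) x)]

/-- The supremum of the operator norms of the derivative of a map. -/
noncomputable def supNormMFDeriv (f : M → M) : ℝ := ⨆ x : M, ‖mfderiv (𝓡 d) (𝓡 d) f x‖

lemma supNormMFDeriv_nonneg (f : M → M) : 0 ≤ supNormMFDeriv (d := d) f :=
  Real.iSup_nonneg fun _ => ContinuousLinearMap.opNorm_nonneg _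

lemma norm_mfderiv_eq_zero_of_dim_zero (hd : d = 0) (f : M → M) (x : M) :
    ‖mfderiv (𝓡 d) (𝓡 d) f x‖ = 0 := by
  subst hd
  have h : mfderiv (𝓡 0) (𝓡 0) f x = 0 := by
    ext v
    exact Subsingleton.elim (α := EuclideanSpace ℝ (Fin 0)) _ _
  rw [h]
  exact ContinuousLinearMap.opNorm_zero

variable [CompactSpace M] [IsManifold (𝓡 d) ∞ M]
  [IsContinuousRiemannianBundle (EuclideanSpace ℝ (Fin d))
    (fun x : M => TangentSpace (𝓡 d) x)]
  [IsRiemannianManifold (𝓡 d) M]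

lemma norm_mfderiv_le_supNormMFDeriv {f : M → M} (hf : ContMDiff (𝓡 d) (𝓡 d) 1 f) (x : M) :
    ‖mfderiv (𝓡 d) (𝓡 d) f x‖ ≤ supNormMFDeriv (d := d) f := by
  obtain ⟨C, hC⟩ := exists_norm_mfderiv_le hf
  refine le_ciSup (f := fun x : M => ‖mfderiv (𝓡 d) (𝓡 d) f x‖) ⟨C, ?_⟩ x
  rintro _ ⟨y, rfl⟩
  exact ContinuousLinearMap.opNorm_le_bound _ C.coe_nonneg (hC y)

lemma supNormMFDeriv_comp_le {f g : M → M} (hf : ContMDiff (𝓡 d) (𝓡 d) 1 f)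
    (hg : ContMDiff (𝓡 d) (𝓡 d) 1 g) :
    supNormMFDeriv (d := d) (f ∘ g) ≤ supNormMFDeriv (d := d) f * supNormMFDeriv (d := d) g := by
  refine Real.iSup_le (fun x => ?_)
    (mul_nonneg (supNormMFDeriv_nonneg f) (supNormMFDeriv_nonneg g))
  rw [mfderiv_comp x (hf.mdifferentiable one_ne_zero _) (hg.mdifferentiable one_ne_zero _)]
  refine (ContinuousLinearMap.opNorm_comp_le _ _).trans ?_
  gcongr
  · exact supNormMFDeriv_nonneg f
  · exact norm_mfderiv_le_supNormMFDeriv hf _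
  · exact norm_mfderiv_le_supNormMFDeriv hg _

lemma edist_le_supNormMFDeriv_mul {f : M → M} (hf : ContMDiff (𝓡 d) (𝓡 d) 1 f) {x y : M}
    (hxy : edist x y ≠ ⊤) :
    edist (f x) (f y) ≤ ENNReal.ofReal (supNormMFDeriv (d := d) f) * edist x y := by
  refine edist_le_of_norm_mfderiv_le (𝓡 d) hf (fun z v => ?_) hxy
  rw [Real.coe_toNNReal _ (supNormMFDeriv_nonneg f)]
  exact ContinuousLinearMap.le_of_opNorm_le _ (norm_mfderiv_le_supNormMFDeriv hf z) v

/-- The composite is the identity, whose derivative has norm 1 once the tangent spaces are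
nontrivial. -/
lemma one_le_supNormMFDeriv_mul [Nonempty M] (hd : d ≠ 0) {f g : M → M}
    (hf : ContMDiff (𝓡 d) (𝓡 d) 1 f) (hg : ContMDiff (𝓡 d) (𝓡 d) 1 g)
    (hfg : Function.LeftInverse f g) :
    1 ≤ supNormMFDeriv (d := d) f * supNormMFDeriv (d := d) g := by
  refine le_trans ?_ (supNormMFDeriv_comp_le hf hg)
  rw [hfg.comp_eq_id]
  obtain ⟨x⟩ := ‹Nonempty M›
  have : Nonempty (Fin d) := ⟨⟨0, Nat.pos_of_ne_zero hd⟩⟩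
  have : Nontrivial (TangentSpace (𝓡 d) x) :=
    inferInstanceAs (Nontrivial (EuclideanSpace ℝ (Fin d)))
  refine le_trans ?_ (norm_mfderiv_le_supNormMFDeriv contMDiff_id x)
  rw [mfderiv_id, ContinuousLinearMap.norm_id]

/-- Taking n-th roots is monotone, hence commutes with the supremum. -/
lemma expansionRoot_eq (T : Diffeomorph (𝓡 d) (𝓡 d) M M 1) {n : ℕ} (hn : n ≠ 0) :
    expansionRoot T n = supNormMFDeriv (d := d) (T^[n]) ^ ((1 : ℝ) / n) := by
  have hT := T.contMDiff.iterate n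
  have hnn (x : M) : 0 ≤ ‖mfderiv (𝓡 d) (𝓡 d) (T^[n]) x‖ := ContinuousLinearMap.opNorm_nonneg _
  have hn' : (0 : ℝ) ≤ 1 / n := by positivity
  apply le_antisymm
  · exact Real.iSup_le (fun x => Real.rpow_le_rpow (ContinuousLinearMap.opNorm_nonneg _)
      (norm_mfderiv_le_supNormMFDeriv hT x) hn') (Real.rpow_nonneg (supNormMFDeriv_nonneg _) _)
  · have hR : 0 ≤ expansionRoot T n := Real.iSup_nonneg fun _ =>
      Real.rpow_nonneg (ContinuousLinearMap.opNorm_nonneg _) _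
    have h : supNormMFDeriv (d := d) (T^[n]) ≤ expansionRoot T n ^ n := by
      refine Real.iSup_le (fun x => ?_) (pow_nonneg hR n)
      calc ‖mfderiv (𝓡 d) (𝓡 d) (T^[n]) x‖
          = (‖mfderiv (𝓡 d) (𝓡 d) (T^[n]) x‖ ^ ((1 : ℝ) / n)) ^ n := by
            rw [one_div, Real.rpow_inv_natCast_pow (hnn x) hn]
        _ ≤ _ := by
          gcongr
          refine le_ciSup (f := fun x : M => ‖mfderiv (𝓡 d) (𝓡 d) (T^[n]) x‖ ^ ((1 : ℝ) / n))
            ⟨supNormMFDeriv (d := d) (T^[n]) ^ ((1 : ℝ) / n), ?_⟩ x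
          rintro _ ⟨y, rfl⟩
          exact Real.rpow_le_rpow (ContinuousLinearMap.opNorm_nonneg _) (norm_mfderiv_le_supNormMFDeriv hT y) hn'
    calc supNormMFDeriv (d := d) (T^[n]) ^ ((1 : ℝ) / n)
        ≤ (expansionRoot T n ^ n) ^ ((1 : ℝ) / n) :=
          Real.rpow_le_rpow (supNormMFDeriv_nonneg _) h hn'
      _ = _ := by rw [one_div, Real.pow_rpow_inv_natCast hR hn]

lemma supNormMFDeriv_iterate_le (T : Diffeomorph (𝓡 d) (𝓡 d) M M 1) {n : ℕ} (hn : 1 ≤ n) :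
    supNormMFDeriv (d := d) (T^[n]) ≤ supNormMFDeriv (d := d) T ^ n := by
  induction n, hn using Nat.le_induction with
  | base => simp
  | succ n hn ih =>
    rw [Function.iterate_succ, pow_succ]
    refine (supNormMFDeriv_comp_le (T.contMDiff.iterate n) T.contMDiff).trans ?_
    gcongr
    exact supNormMFDeriv_nonneg _

lemma supNormMFDeriv_iterate_pos [Nonempty M] (hd : d ≠ 0) (T : Diffeomorph (𝓡 d) (𝓡 d) M M 1)
    (n : ℕ) : 0 < supNormMFDeriv (d := d) (T^[n]) := by
  have h := one_le_supNormMFDeriv_mul hd (T.symm.contMDiff.iterate n) (T.contMDiff.iterate n)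
    (T.toEquiv.left_inv.iterate n)
  refine (supNormMFDeriv_nonneg _).lt_of_ne fun h0 => ?_
  rw [← h0, mul_zero] at h
  linarith

/-- Fekete's lemma: by the chain rule, the logarithm of the sup norm is subadditive in n; the growth
of the inverse bounds it below linearly. -/
lemma tendsto_expansionRoot [Nonempty M] (T : Diffeomorph (𝓡 d) (𝓡 d) M M 1) :
    Tendsto (expansionRoot T) atTop (𝓝 (expansionLimit T)) := by
  refine tendsto_nhds_limUnder ?_
  by_cases hd : d = 0
  · refine ⟨0, tendsto_const_nhds.congr' ?_⟩
    filter_upwards [eventually_ge_atTop 1] with n hn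
    have hn0 : ((1 : ℝ) / n) ≠ 0 := by positivity
    simp only [expansionRoot, norm_mfderiv_eq_zero_of_dim_zero hd, Real.zero_rpow hn0,
      ciSup_const]
  set S : ℕ → ℝ := fun n => supNormMFDeriv (d := d) (T^[n]) with hS
  have hpos : ∀ n, 0 < S n := supNormMFDeriv_iterate_pos hd T
  have hsub : Subadditive fun n => Real.log (S n) := by
    intro m n
    rw [← Real.log_mul (hpos m).ne' (hpos n).ne']
    refine Real.log_le_log (hpos _) ?_
    simp only [hS, Function.iterate_add]
    exact supNormMFDeriv_comp_le (T.contMDiff.iterate m) (T.contMDiff.iterate n)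
  have hbdd : BddBelow (range fun n : ℕ => Real.log (S n) / n) := by
    -- The `0` covers the term n = 0, where division by zero gives 0.
    refine ⟨min 0 (-Real.log (supNormMFDeriv (d := d) T.symm)), ?_⟩
    rintro _ ⟨n, rfl⟩
    rcases Nat.eq_zero_or_pos n with rfl | hn
    · simp
    refine (min_le_right _ _).trans ?_
    have hn' : (0 : ℝ) < n := by exact_mod_cast hn
    rw [le_div_iff₀ hn']
    have h1 := one_le_supNormMFDeriv_mul hd (T.symm.contMDiff.iterate n) (T.contMDiff.iterate n)
      (T.toEquiv.left_inv.iterate n)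
    have h2 := supNormMFDeriv_iterate_pos hd T.symm n
    have h3 := Real.log_nonneg h1
    rw [Real.log_mul h2.ne' (hpos n).ne'] at h3
    have h4 := Real.log_le_log h2 (supNormMFDeriv_iterate_le T.symm hn)
    rw [Real.log_pow] at h4
    simp only [hS]
    linarith
  refine ⟨Real.exp hsub.lim, (((Real.continuous_exp.tendsto _).comp
    (hsub.tendsto_lim hbdd))).congr' ?_⟩
  filter_upwards [eventually_ge_atTop 1] with n hn
  rw [expansionRoot_eq T (by omega), Real.rpow_def_of_pos (hpos n)]
  simp only [Function.comp_apply, mul_one_div]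

/-- Since Λ⁺Λ⁻ ≥ 1, the larger is at least 1; hence powers of any Λ' > Λ increase with the exponent.
-/
lemma one_le_expansionRate [Nonempty M] (hd : d ≠ 0) (T : Diffeomorph (𝓡 d) (𝓡 d) M M 1) :
    1 ≤ expansionRate T := by
  have h : 1 ≤ expansionLimit T.symm * expansionLimit T := by
    refine ge_of_tendsto ((tendsto_expansionRoot T.symm).mul (tendsto_expansionRoot T)) ?_
    filter_upwards [eventually_ge_atTop 1] with n hn
    rw [expansionRoot_eq T (by omega), expansionRoot_eq T.symm (by omega),
      ← Real.mul_rpow (supNormMFDeriv_nonneg _) (supNormMFDeriv_nonneg _)]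
    exact Real.one_le_rpow (one_le_supNormMFDeriv_mul hd (T.symm.contMDiff.iterate n)
      (T.contMDiff.iterate n) (T.toEquiv.left_inv.iterate n)) (by positivity)
  have h0 : 0 ≤ expansionLimit T := ge_of_tendsto' (tendsto_expansionRoot T)
    fun n => Real.iSup_nonneg fun _ =>
      Real.rpow_nonneg (ContinuousLinearMap.opNorm_nonneg _) _
  by_contra! hlt
  have h1 := (le_max_left _ _).trans_lt hlt
  have h2 := (le_max_right _ _).trans_lt hlt
  nlinarith

lemma exists_supNormMFDeriv_iterate_le [Nonempty M] (T : Diffeomorph (𝓡 d) (𝓡 d) M M 1) {Λ : ℝ}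
    (hΛ : expansionLimit T < Λ) (h1 : 1 ≤ Λ) :
    ∃ C : ℝ, 0 < C ∧ ∀ n : ℕ, supNormMFDeriv (d := d) (T^[n]) ≤ C * Λ ^ n := by
  obtain ⟨N, hN⟩ := eventually_atTop.1 ((tendsto_expansionRoot T).eventually_lt_const hΛ)
  have hsum : 0 ≤ ∑ i ∈ Finset.range (N + 1), supNormMFDeriv (d := d) (T^[i]) :=
    Finset.sum_nonneg fun _ _ => supNormMFDeriv_nonneg _
  -- The sum absorbs the finitely many n before the root falls below Λ.
  refine ⟨1 + ∑ i ∈ Finset.range (N + 1), supNormMFDeriv (d := d) (T^[i]), by linarith,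
    fun n => ?_⟩
  have hpow : 1 ≤ Λ ^ n := one_le_pow₀ h1
  rcases le_or_gt n N with hn | hn
  · have h2 := Finset.single_le_sum (f := fun i => supNormMFDeriv (d := d) (T^[i]))
      (fun _ _ => supNormMFDeriv_nonneg _) (Finset.mem_range.2 (Nat.lt_succ_of_le hn))
    nlinarith
  · have h2 := hN n hn.le
    have hn0 : n ≠ 0 := by omega
    rw [expansionRoot_eq T hn0] at h2
    have h3 : supNormMFDeriv (d := d) (T^[n]) ≤ Λ ^ n := by
      calc supNormMFDeriv (d := d) (T^[n])
          = (supNormMFDeriv (d := d) (T^[n]) ^ ((1 : ℝ) / n)) ^ n := by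
            rw [one_div, Real.rpow_inv_natCast_pow (supNormMFDeriv_nonneg _) hn0]
        _ ≤ _ := pow_le_pow_left₀ (Real.rpow_nonneg (supNormMFDeriv_nonneg _) _) h2.le n
    nlinarith

end ExpansionRate

/-! ### Expansion of tangent vectors by iterates. -/

section Hyperbolicity

open Set Filter Manifold

variable {d : ℕ} {M : Type*} [TopologicalSpace M]
  [ChartedSpace (EuclideanSpace ℝ (Fin d)) M]

lemma map_mfderiv_iterate {T : M → M} (hT : ContMDiff (𝓡 d) (𝓡 d) 1 T)
    {V : ∀ x : M, Submodule ℝ (TangentSpace (𝓡 d) x)}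
    (hV : ∀ x, (V x).map (mfderiv (𝓡 d) (𝓡 d) T x).toLinearMap = V (T x)) (n : ℕ) (x : M) :
    (V x).map (mfderiv (𝓡 d) (𝓡 d) (T^[n]) x).toLinearMap = V (T^[n] x) := by
  induction n generalizing x with
  | zero =>
    simp only [Function.iterate_zero, mfderiv_id]
    exact Submodule.map_id _
  | succ n ih =>
    have h : mfderiv (𝓡 d) (𝓡 d) (T^[n + 1]) x =
        (mfderiv (𝓡 d) (𝓡 d) (T^[n]) (T x)).comp (mfderiv (𝓡 d) (𝓡 d) T x) := by
      rw [Function.iterate_succ]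
      exact mfderiv_comp x ((hT.iterate n).mdifferentiable one_ne_zero _)
        (hT.mdifferentiable one_ne_zero _)
    rw [h]
    change (V x).map ((mfderiv (𝓡 d) (𝓡 d) (T^[n]) (T x)).toLinearMap.comp
      (mfderiv (𝓡 d) (𝓡 d) T x).toLinearMap) = _
    rw [Submodule.map_comp, hV]
    exact ih (T x)

variable [RiemannianBundle (fun x : M => TangentSpace (𝓡 d) x)]

/-- Stated for norms because the tangent spaces at `f (g x)` and `x` carry norms matched only after
rewriting the base point. -/
lemma norm_mfderiv_mfderiv_of_leftInverse {f g : M → M} (hf : ContMDiff (𝓡 d) (𝓡 d) 1 f)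
    (hg : ContMDiff (𝓡 d) (𝓡 d) 1 g) (hfg : Function.LeftInverse f g) (x : M)
    (v : TangentSpace (𝓡 d) x) :
    ‖mfderiv (𝓡 d) (𝓡 d) f (g x) (mfderiv (𝓡 d) (𝓡 d) g x v)‖ = ‖v‖ := by
  have h := mfderiv_comp x (hf.mdifferentiable one_ne_zero (g x))
    (hg.mdifferentiable one_ne_zero x)
  rw [hfg.comp_eq_id, mfderiv_id] at h
  have h2 : (mfderiv (𝓡 d) (𝓡 d) f (g x) (mfderiv (𝓡 d) (𝓡 d) g x v) :
      EuclideanSpace ℝ (Fin d)) = v := congr($h v).symm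
  have h3 : ∀ q, q = x → ∀ w : EuclideanSpace ℝ (Fin d),
      ‖(show TangentSpace (𝓡 d) q from w)‖ = ‖(show TangentSpace (𝓡 d) x from w)‖ := by
    rintro _ rfl w
    rfl
  exact (h3 _ (hfg x) _).trans (congrArg (fun w : TangentSpace (𝓡 d) x => ‖w‖) h2)

variable [IsManifold (𝓡 d) ∞ M]

/-- For an Anosov diffeomorphism, a high iterate of `T` or of its inverse expands any given tangent
vector by a prescribed factor. -/
lemma IsAnosov.exists_iterate_expansion {T : Diffeomorph (𝓡 d) (𝓡 d) M M 1} (hA : IsAnosov T)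
    (K : ℝ) : ∃ N : ℕ, ∀ x (v : TangentSpace (𝓡 d) x),
      K * ‖v‖ ≤ ‖mfderiv (𝓡 d) (𝓡 d) (T^[N]) x v‖ ∨
      K * ‖v‖ ≤ ‖mfderiv (𝓡 d) (𝓡 d) (T.symm^[N]) x v‖ := by
  obtain ⟨Eu, Es, hcompl, hEu, hEs, r, C, hr0, hr1, hC, hbd⟩ := hA
  -- The larger of the two components of v has norm at least ‖v‖/2 and is stretched by q; the other
  -- contributes at most κ ≤ 1 times that norm. This leaves (q - 1)/2 ≥ K.
  set q : ℝ := 2 * max K 0 + 1 with hq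
  have hKq : K ≤ (q - 1) / 2 := by simp [hq]
  have hq1 : 1 ≤ q := by simp [hq]
  obtain ⟨N, hN⟩ := exists_pow_lt_of_lt_one (show 0 < 1 / (q * C) by positivity) hr1
  set κ : ℝ := C * r ^ N with hκ
  have hκ0 : 0 ≤ κ := by positivity
  have hqκ : q * κ ≤ 1 := by
    rw [lt_div_iff₀ (by positivity)] at hN
    rw [hκ]
    linarith
  have hκ1 : κ ≤ 1 := by nlinarith
  have hT := T.contMDiff.iterate N
  have hT' := T.symm.contMDiff.iterate N
  have hl : Function.LeftInverse T.symm^[N] T^[N] := T.toEquiv.left_inv.iterate N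
  have hr : Function.LeftInverse T^[N] T.symm^[N] := T.toEquiv.right_inv.iterate N
  -- Contraction by the inverse, applied to the image vector, is expansion.
  have hu : ∀ x, ∀ u ∈ Eu x, q * ‖u‖ ≤ ‖mfderiv (𝓡 d) (𝓡 d) (T^[N]) x u‖ := by
    intro x u hu
    have h1 : mfderiv (𝓡 d) (𝓡 d) (T^[N]) x u ∈ Eu (T^[N] x) := by
      rw [← map_mfderiv_iterate T.contMDiff hEu N x]
      exact Submodule.mem_map_of_mem hu
    have h2 := (hbd N (T^[N] x)).1 _ h1
    rw [norm_mfderiv_mfderiv_of_leftInverse hT' hT hl] at h2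
    nlinarith [norm_nonneg (mfderiv (𝓡 d) (𝓡 d) (T^[N]) x u)]
  have hs : ∀ x, ∀ s ∈ Es x, q * ‖s‖ ≤ ‖mfderiv (𝓡 d) (𝓡 d) (T.symm^[N]) x s‖ := by
    intro x
    obtain ⟨y, rfl⟩ : ∃ y, T^[N] y = x := ⟨_, hr x⟩
    intro s hs
    rw [← map_mfderiv_iterate T.contMDiff hEs N y] at hs
    obtain ⟨s', hs', rfl⟩ := hs
    change q * ‖mfderiv (𝓡 d) (𝓡 d) (T^[N]) y s'‖ ≤
      ‖mfderiv (𝓡 d) (𝓡 d) (T.symm^[N]) (T^[N] y) (mfderiv (𝓡 d) (𝓡 d) (T^[N]) y s')‖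
    have h2 := (hbd N y).2 s' hs'
    rw [norm_mfderiv_mfderiv_of_leftInverse hT' hT hl]
    nlinarith [norm_nonneg s']
  refine ⟨N, fun x v => ?_⟩
  obtain ⟨u, hu', s, hs', rfl⟩ : ∃ u ∈ Eu x, ∃ s ∈ Es x, u + s = v :=
    Submodule.mem_sup.1 ((hcompl x).sup_eq_top ▸ Submodule.mem_top)
  have hadd := norm_add_le u s
  rcases le_total ‖s‖ ‖u‖ with h | h
  · left
    have h1 := hu x u hu'
    have h2 := (hbd N x).2 s hs'
    have h3 := norm_le_add_norm_add (mfderiv (𝓡 d) (𝓡 d) (T^[N]) x u)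
      (mfderiv (𝓡 d) (𝓡 d) (T^[N]) x s)
    rw [← map_add] at h3
    nlinarith [norm_nonneg s, norm_nonneg u, norm_nonneg (u + s)]
  · right
    have h1 := hs x s hs'
    have h2 := (hbd N x).1 u hu'
    have h3 := norm_le_add_norm_add (mfderiv (𝓡 d) (𝓡 d) (T.symm^[N]) x s)
      (mfderiv (𝓡 d) (𝓡 d) (T.symm^[N]) x u)
    rw [← map_add, add_comm s u] at h3
    nlinarith [norm_nonneg s, norm_nonneg u, norm_nonneg (u + s)]

end Hyperbolicity

/-! ### Separation of periodic orbits. -/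

open scoped ENNReal in
/-- If one of the `N`-th iterates of an invertible map and its inverse doubles all distances smaller
than `ε`, then two periodic orbits become `ε`-separated. -/
lemma exists_le_edist_iterate_of_expansion {M : Type*} [EMetricSpace M] {T S : M → M}
    (hS : Function.LeftInverse S T) {N : ℕ} {ε : ℝ≥0∞}
    (hε : ∀ x y : M, edist x y < ε → 2 * edist x y ≤ edist (T^[N] x) (T^[N] y) ∨
      2 * edist x y ≤ edist (S^[N] x) (S^[N] y))
    {n : ℕ} (hn : 1 ≤ n) {x y : M} (hxy : x ≠ y) (hx : T^[n] x = x) (hy : T^[n] y = y) :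
    ∃ j < n, ε ≤ edist (T^[j] x) (T^[j] y) := by
  by_contra! hlt
  obtain ⟨j, hj, hmax⟩ := Finset.exists_max_image (Finset.range n)
    (fun j => edist (T^[j] x) (T^[j] y)) ⟨0, Finset.mem_range.2 hn⟩
  have hall : ∀ m, edist (T^[m] x) (T^[m] y) ≤ edist (T^[j] x) (T^[j] y) := by
    intro m
    rw [← Function.IsPeriodicPt.iterate_mod_apply (f := T) (n := n) hx m,
      ← Function.IsPeriodicPt.iterate_mod_apply (f := T) (n := n) hy m]
    exact hmax _ (Finset.mem_range.2 (Nat.mod_lt _ hn))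
  have hjlt := hlt j (Finset.mem_range.1 hj)
  have h2 : 2 * edist (T^[j] x) (T^[j] y) ≤ edist (T^[j] x) (T^[j] y) := by
    rcases hε _ _ hjlt with h | h
    · refine h.trans ?_
      rw [← Function.iterate_add_apply, ← Function.iterate_add_apply]
      exact hall _
    -- On n-periodic points the inverse acts as the (n - 1)-st iterate, so backward distances are
    -- also covered by the maximum.
    · have hback : ∀ z, T^[n] z = z → S^[N] (T^[j] z) = T^[j + N * (n - 1)] z := by
        intro z hz
        have h3 : T^[j] z = T^[N] (T^[j + N * (n - 1)] z) := by
          rw [← Function.iterate_add_apply]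
          have h4 : N + (j + N * (n - 1)) = j + n * N := by
            obtain ⟨k, rfl⟩ := Nat.exists_eq_add_of_le hn
            simp only [Nat.add_sub_cancel_left]
            ring
          rw [h4, Function.iterate_add_apply, Function.IsPeriodicPt.mul_const (f := T) hz N]
        rw [h3, hS.iterate N]
      rw [hback x hx, hback y hy] at h
      exact h.trans (hall _)
  -- In `ℝ≥0∞`, 2a ≤ a is absurd only for a neither 0 nor ⊤.
  have h0 : edist (T^[j] x) (T^[j] y) ≠ 0 := by
    rw [Ne, edist_eq_zero]
    exact (hS.injective.iterate j).ne hxy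
  rw [two_mul] at h2
  exact absurd h2 (not_le.2 (ENNReal.lt_add_right hjlt.ne_top h0))

/-! ### The lower bound on distances. -/

theorem mainTheorem3 {d : ℕ} {M : Type*} [EMetricSpace M] [CompactSpace M]
    [ChartedSpace (EuclideanSpace ℝ (Fin d)) M] [IsManifold (𝓡 d) ∞ M]
    [RiemannianBundle (fun x : M => TangentSpace (𝓡 d) x)]
    [IsContMDiffRiemannianBundle (𝓡 d) ∞ (EuclideanSpace ℝ (Fin d))
      (fun x : M => TangentSpace (𝓡 d) x)]
    [IsRiemannianManifold (𝓡 d) M]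
    (T : Diffeomorph (𝓡 d) (𝓡 d) M M 1) (hA : IsAnosov T) (hT : IsTransitive T) :
    Filter.Tendsto (expansionRoot T) Filter.atTop (𝓝 (expansionLimit T)) ∧
    Filter.Tendsto (expansionRoot T.symm) Filter.atTop (𝓝 (expansionLimit T.symm)) ∧
    ∀ Λ' : ℝ, expansionRate T < Λ' →
      ∃ C : ℝ, 0 < C ∧ ∀ n : ℕ, 1 ≤ n → ∀ x y : M, x ≠ y → T^[n] x = x → T^[n] y = y →
        ENNReal.ofReal (C / Λ' ^ ((n : ℝ) / 2)) ≤ edist x y := by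
  have : Nonempty M := hT.nonempty
  have : IsContinuousRiemannianBundle (EuclideanSpace ℝ (Fin d))
      (fun x : M => TangentSpace (𝓡 d) x) := by
    obtain ⟨g, hg, h⟩ := IsContMDiffRiemannianBundle.exists_contMDiff (IB := 𝓡 d) (n := ∞)
      (F := EuclideanSpace ℝ (Fin d)) (E := fun x : M => TangentSpace (𝓡 d) x)
    exact ⟨g, hg.continuous, h⟩
  refine ⟨tendsto_expansionRoot T, tendsto_expansionRoot T.symm, fun Λ hΛ => ?_⟩
  by_cases hd : d = 0
  -- In dimension 0 the identity has zero derivative, so distinct points lie at infinite distance.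
  · refine ⟨1, one_pos, fun n _ x y hxy _ _ => ?_⟩
    by_cases htop : edist x y = ⊤
    · simp [htop]
    · have h := edist_le_supNormMFDeriv_mul (d := d) contMDiff_id htop
      have h0 : supNormMFDeriv (d := d) (id : M → M) = 0 := by
        simp only [supNormMFDeriv, norm_mfderiv_eq_zero_of_dim_zero hd, ciSup_const]
      simp only [h0, id, ENNReal.ofReal_zero, zero_mul, nonpos_iff_eq_zero, edist_eq_zero] at h
      exact absurd h hxy
  have hΛ1 : 1 ≤ Λ := (one_le_expansionRate hd T).trans hΛ.le
  obtain ⟨C₁, hC₁, h₁⟩ := exists_supNormMFDeriv_iterate_le T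
    ((le_max_left _ _).trans_lt hΛ) hΛ1
  obtain ⟨C₂, hC₂, h₂⟩ := exists_supNormMFDeriv_iterate_le T.symm
    ((le_max_right _ _).trans_lt hΛ) hΛ1
  obtain ⟨K, hK⟩ := exists_edist_expansion (𝓡 d) M
  obtain ⟨N, hN⟩ := hA.exists_iterate_expansion K
  obtain ⟨ε, hε, hexp⟩ := hK _ _ (T.contMDiff.iterate N) (T.symm.contMDiff.iterate N) hN
  obtain ⟨e, he0, heε⟩ : ∃ e : ℝ, 0 < e ∧ ENNReal.ofReal e ≤ ε := by
    obtain ⟨e, he, heε⟩ := ENNReal.lt_iff_exists_nnreal_btwn.1 hε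
    exact ⟨e, by exact_mod_cast he, by simpa using heε.le⟩
  refine ⟨e / max C₁ C₂, by positivity, fun n hn x y hxy hx hy => ?_⟩
  by_cases htop : edist x y = ⊤
  · simp [htop]
  have hΛ0 : 0 < Λ := by linarith
  -- Used with f the m-th iterate of T or of its inverse, whichever reaches the separation time with
  -- m ≤ n/2.
  have key : ∀ (f : M → M) (m : ℕ), ContMDiff (𝓡 d) (𝓡 d) 1 f → 2 * m ≤ n →
      supNormMFDeriv (d := d) f ≤ max C₁ C₂ * Λ ^ m → ε ≤ edist (f x) (f y) →
      ENNReal.ofReal (e / max C₁ C₂ / Λ ^ ((n : ℝ) / 2)) ≤ edist x y := by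
    intro f m hf hm hle hsep
    have hpow : Λ ^ m ≤ Λ ^ ((n : ℝ) / 2) := by
      rw [← Real.rpow_natCast]
      refine Real.rpow_le_rpow_of_exponent_le hΛ1 ?_
      have : (2 * m : ℝ) ≤ n := by exact_mod_cast hm
      linarith
    rw [div_div, ENNReal.ofReal_div_of_pos (by positivity)]
    refine ENNReal.div_le_of_le_mul' ?_
    refine (heε.trans (hsep.trans (edist_le_supNormMFDeriv_mul hf htop))).trans ?_
    gcongr
    exact hle.trans (by gcongr)
  obtain ⟨j, hj, hsep⟩ := exists_le_edist_iterate_of_expansion (T := T) (S := T.symm)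
    T.toEquiv.left_inv hexp hn hxy hx hy
  rcases le_total (2 * j) n with h | h
  · exact key (T^[j]) j (T.contMDiff.iterate j) h ((h₁ j).trans (by gcongr; exact le_max_left _ _))
      hsep
  -- By periodicity, n - j backward steps lead to the same point as j forward steps.
  · have hback : ∀ z, T^[n] z = z → T.symm^[n - j] z = T^[j] z := by
      intro z hz
      conv_lhs => rw [← hz, show n = (n - j) + j by omega, Function.iterate_add_apply]
      rw [Nat.add_sub_cancel]
      exact T.toEquiv.left_inv.iterate (n - j) _
    refine key (T.symm^[n - j]) (n - j) (T.symm.contMDiff.iterate _) (by omega)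
      ((h₂ _).trans (by gcongr; exact le_max_right _ _)) ?_
    rwa [hback x hx, hback y hy]
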